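/- Consider a SISO-OFDM system (one transmit and one receive antenna) with $N\ge 1$ subcarriers over a length-$L$ Rayleigh-fading channel: $H[0],\dots,H[L-1]$ are independent $\mathcal{CN}(0,1)$ random variables, and the real power delay profile $\sigma_0,\dots,\sigma_{L-1}$ satisfies $\sum_{p=0}^{L-1}\sigma_p^2=1$. For $k=0,\dots,N-1$ let $$H_k=\sum_{p=0}^{L-1}\sigma_p\,H[p]\,e^{-2\pi i kp/N},\qquad \mathcal I_k=\log_2\bigl(1+\gamma|H_k|^2\bigr),\qquad \mathcal I_{\rm ofdm}=\frac1N\sum_{k=0}^{N-1}\mathcal I_k,$$ where $\gamma>0$ is the SNR, and let $\rho_d=\sum_{p=0}^{L-1}\sigma_p^2e^{-2\pi i dp/N}$. Then $E[H_k\overline{H_\ell}]=\rho_{k-\ell}$ for all $0\le k,\ell\le N-1$, the mutual information $\mathcal I_{\rm ofdm}$ has a finite second moment for every $\gamma>0$, and as $\gamma\to\infty$ its variance converges: $$\lim_{\gamma\to\infty}{\rm Var}(\mathcal I_{\rm ofdm})=(\log_2 e)^2\left(\frac{2}{N^2}\sum_{d=1}^{N-1}(N-d)\,{\rm Li}_2\bigl(1-|\rho_d|^2\bigr)+\frac{\pi^2}{6N}\right),$$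 where ${\rm Li}_2$ denotes the dilogarithm in the convention of Abramowitz and Stegun, ${\rm Li}_2(x)=-\int_1^x\frac{\ln t}{t-1}\,dt$ for $x\ge 0$ (so ${\rm Li}_2(1)=0$ and ${\rm Li}_2(0)=\pi^2/6$; in the other common convention it is $\sum_{k\ge1}(1-x)^k/k^2$ for $0\le x\le 1$). -/

import Mathlib

open MeasureTheory ProbabilityTheory
open scoped Matrix NNReal

noncomputable section

namespace OFDM

/-- The circularly symmetric complex Gaussian law `CN(0,1)`: real and imaginary part are
independent real Gaussians with mean `0` and variance `1/2`. -/
def stdComplexGaussian : Measure ℂ :=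
  ((gaussianReal 0 (1 / 2)).prod (gaussianReal 0 (1 / 2))).map
    (fun z : ℝ × ℝ => (⟨z.1, z.2⟩ : ℂ))

/-- Spatially uncorrelated Rayleigh fading: the entries of the `Nr × Nt` taps `H[0], …, H[L-1]`
of the channel impulse response are independent and each has law `CN(0,1)`. -/
structure IsRayleighFading {Ω : Type*} [MeasurableSpace Ω] (μ : Measure Ω) {L Nr Nt : ℕ}
    (H : Fin L → Ω → Matrix (Fin Nr) (Fin Nt) ℂ) : Prop where
  indep : iIndepFun (fun (x : Fin L × Fin Nr × Fin Nt) (ω : Ω) => H x.1 ω x.2.1 x.2.2) μ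
  law : ∀ p i j, HasLaw (fun ω => H p ω i j) stdComplexGaussian μ

/-- The channel matrix of subcarrier `k`: `H_k = ∑_p σ_p H[p] exp(-2πi (k/N) p)`. -/
def subcarrierChannel {Ω : Type*} {L Nr Nt : ℕ} (N : ℕ) (σ : Fin L → ℝ)
    (H : Fin L → Ω → Matrix (Fin Nr) (Fin Nt) ℂ) (k : ℕ) (ω : Ω) :
    Matrix (Fin Nr) (Fin Nt) ℂ :=
  ∑ p : Fin L,
    ((σ p : ℂ) * Complex.exp (-(2 * Real.pi * Complex.I * ((k : ℂ) / (N : ℂ)) * (p : ℕ)))) • H p ω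

/-- The frequency correlation coefficient `ρ_d = ∑_p σ_p² exp(-2πi d p / N)`. -/
def freqCorr {L : ℕ} (N : ℕ) (σ : Fin L → ℝ) (d : ℤ) : ℂ :=
  ∑ p : Fin L,
    (σ p : ℂ) ^ 2 * Complex.exp (-(2 * Real.pi * Complex.I * (d : ℂ) * (p : ℕ) / (N : ℂ)))

/-- The mutual information `log₂ det (I + (γ/Nt) A A†)` of a flat channel with matrix `A`
(the determinant is a real number, at least `1` for `γ ≥ 0`). -/
def flatMutualInfo {Nr Nt : ℕ} (γ : ℝ) (A : Matrix (Fin Nr) (Fin Nt) ℂ) : ℝ :=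
  Real.logb 2 (Matrix.det (1 + ((γ / Nt : ℝ) : ℂ) • (A * Aᴴ))).re

/-- The OFDM mutual information in b/s/Hz: the average over the `N` subcarriers. -/
def mutualInfo {Ω : Type*} {L Nr Nt : ℕ} (N : ℕ) (σ : Fin L → ℝ)
    (H : Fin L → Ω → Matrix (Fin Nr) (Fin Nt) ℂ) (γ : ℝ) (ω : Ω) : ℝ :=
  (1 / (N : ℝ)) * ∑ k ∈ Finset.range N, flatMutualInfo γ (subcarrierChannel N σ H k ω)

/-- The dilogarithm in the convention of Abramowitz and Stegun (Spence's function),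
`x ↦ -∫_1^x ln t / (t - 1) dt`. It takes the value `0` at `1` and `π²/6` at `0`. -/
def dilog (x : ℝ) : ℝ :=
  -∫ t in (1 : ℝ)..x, Real.log t / (t - 1)

end OFDM

end

namespace OFDM

/-! The variance of the average is a double sum of covariances of `log (1 + γ|H_k|²)` and `log (1 +
γ|H_l|²)`, so it suffices to find the limit of each covariance. It depends only on `r = |ρ_{k-l}|²`,
and the diagonal `k = l` is just the case `r = 1`.

Each `H_k` is a linear form in the independent Gaussian taps with a coefficient vector of norm one.
Hence `|H_k|²` and `|H_l|²` have joint Laplace transform `1 / ((1+t)(1+s) - r t s)`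
(`integral_exp_neg_norm_sq_of_iIndepFun`). With `ε = 1/γ`, the Frullani-type formula `log (1 + a/ε)
= ∫₀^∞ e^{-εt} (1 - e^{-ta}) / t dt` turns the covariance into a double integral of `e^{-ε(t+s)}`
against (joint transform minus product of marginals) divided by `t s`. That quotient is `covKernel r
t s`, which is nonnegative (`lintegral_mul_log_eq_add`).

As `ε → 0` the exponential tends to one, and the kernel itself dominates. Its integral over the
quadrant is elementary in one variable and a dilogarithm in the other, with value `dilog (1 - r)`
(`lintegral_covKernel`). Grouping the pairs by `d = k - l` gives the weights `N - d`, and `dilog 0 =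
π²/6` gives the diagonal term. -/

/-! ### Gaussian integrals for `CN(0,1)` -/

theorem integral_cexp_quadratic_gaussianReal {t : ℝ} (ht : 0 ≤ t) (b : ℂ) :
    ∫ x : ℝ, Complex.exp (-(t : ℂ) * x ^ 2 + 2 * b * x) ∂(gaussianReal 0 (1 / 2)) =
      Complex.exp (b ^ 2 / (1 + t)) / (Real.sqrt (1 + t) : ℝ) := by
  have h1 : (0 : ℝ) < 1 + t := by linarith
  rw [integral_gaussianReal_eq_integral_smul (by norm_num)]
  have h2 : ∀ x : ℝ, gaussianPDFReal 0 (1 / 2) x •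
      Complex.exp (-(t : ℂ) * x ^ 2 + 2 * b * x) =
      ((Real.sqrt Real.pi)⁻¹ : ℝ) * Complex.exp (-(1 + t : ℂ) * x ^ 2 + 2 * b * x + 0) := by
    intro x
    rw [gaussianPDFReal, Complex.real_smul]
    push_cast
    rw [mul_assoc, ← Complex.exp_add]
    congr 2
    · congr 2
      ring_nf
    · ring_nf
  simp_rw [h2]
  rw [integral_const_mul, integral_cexp_quadratic (by simp; linarith)]
  have h3 : (Real.pi / -(-(1 + t : ℂ))) ^ (1 / 2 : ℂ) = (Real.sqrt (Real.pi / (1 + t)) : ℝ) := by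
    rw [Real.sqrt_eq_rpow, Complex.ofReal_cpow (by positivity)]
    push_cast
    rw [neg_neg]
  rw [h3, Real.sqrt_div Real.pi_pos.le]
  have h4 : (Real.sqrt Real.pi : ℂ) ≠ 0 := by
    exact_mod_cast (Real.sqrt_pos.2 Real.pi_pos).ne'
  have h5 : (Real.sqrt (1 + t) : ℂ) ≠ 0 := by
    exact_mod_cast (Real.sqrt_pos.2 h1).ne'
  have h6 : (1 + t : ℂ) ≠ 0 := by exact_mod_cast h1.ne'
  have h7 : (0 : ℂ) - (2 * b) ^ 2 / (4 * -(1 + t)) = b ^ 2 / (1 + t) := by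
    field_simp
    ring
  rw [h7]
  push_cast
  field_simp

theorem measurable_complex_mk : Measurable (fun z : ℝ × ℝ => (⟨z.1, z.2⟩ : ℂ)) :=
  Complex.measurableEquivRealProd.symm.measurable

instance isProbabilityMeasure_stdComplexGaussian : IsProbabilityMeasure stdComplexGaussian :=
  Measure.isProbabilityMeasure_map measurable_complex_mk.aemeasurable

theorem integral_cexp_quadratic_stdComplexGaussian {t : ℝ} (ht : 0 ≤ t) (b c : ℂ) :
    ∫ z : ℂ, Complex.exp (-(t : ℂ) * (‖z‖ ^ 2 : ℝ) + 2 * (b * z.re + c * z.im))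
      ∂stdComplexGaussian = Complex.exp ((b ^ 2 + c ^ 2) / (1 + t)) / (1 + t) := by
  have h1 : (0 : ℝ) < 1 + t := by linarith
  rw [stdComplexGaussian, integral_map measurable_complex_mk.aemeasurable
    (Measurable.aestronglyMeasurable (by fun_prop))]
  have h2 : ∀ z : ℝ × ℝ, Complex.exp (-(t : ℂ) * (‖(⟨z.1, z.2⟩ : ℂ)‖ ^ 2 : ℝ) +
      2 * (b * z.1 + c * z.2)) = Complex.exp (-(t : ℂ) * z.1 ^ 2 + 2 * b * z.1) *
        Complex.exp (-(t : ℂ) * z.2 ^ 2 + 2 * c * z.2) := by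
    intro z
    rw [← Complex.exp_add, ← Complex.normSq_eq_norm_sq, Complex.normSq_mk]
    congr 1
    push_cast
    ring
  simp_rw [h2]
  rw [integral_prod_mul (fun x : ℝ => Complex.exp (-(t : ℂ) * x ^ 2 + 2 * b * x))
    (fun x : ℝ => Complex.exp (-(t : ℂ) * x ^ 2 + 2 * c * x)),
    integral_cexp_quadratic_gaussianReal ht, integral_cexp_quadratic_gaussianReal ht,
    div_mul_div_comm, ← Complex.exp_add, ← add_div]
  congr 1
  rw [← Complex.ofReal_mul, Real.mul_self_sqrt h1.le]
  push_cast
  rfl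

theorem integral_cexp_re_mul_stdComplexGaussian (w : ℂ) :
    ∫ z : ℂ, Complex.exp (2 * Complex.I * ((w * z).re : ℝ)) ∂stdComplexGaussian =
      Complex.exp (-(‖w‖ ^ 2 : ℝ)) := by
  -- The case `t = 0`, with coefficients read off from `Re (w z) = w.re z.re - w.im z.im`.
  have h := integral_cexp_quadratic_stdComplexGaussian le_rfl
    (Complex.I * w.re) (-(Complex.I * w.im))
  convert h using 2
  · ext z
    congr 1
    simp only [Complex.mul_re]
    push_cast
    ring
  · rw [← Complex.normSq_eq_norm_sq, Complex.normSq_apply]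
    simp only [neg_sq, mul_pow, Complex.I_sq]
    push_cast
    simp
    congr 1
    ring

variable {Ω : Type*} [MeasurableSpace Ω] {μ : Measure Ω}

/-! ### Joint Laplace transform of two squared moduli -/

section JointLaplaceTransform

variable {ι : Type*} [Fintype ι]

theorem integral_cexp_re_sum_of_iIndepFun [IsProbabilityMeasure μ] {h : ι → Ω → ℂ}
    (hind : iIndepFun h μ) (hlaw : ∀ p, HasLaw (h p) stdComplexGaussian μ) (w : ι → ℂ) :
    ∫ ω, Complex.exp (2 * Complex.I * ((∑ p, w p * h p ω).re : ℝ)) ∂μ =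
      Complex.exp (-(∑ p, ‖w p‖ ^ 2 : ℝ)) := by
  have h1 : ∀ ω, Complex.exp (2 * Complex.I * ((∑ p, w p * h p ω).re : ℝ)) =
      ∏ p, (fun z : ℂ => Complex.exp (2 * Complex.I * ((w p * z).re : ℝ))) (h p ω) := by
    intro ω
    rw [← Complex.exp_sum, ← Finset.mul_sum, Complex.re_sum]
    push_cast
    rfl
  simp_rw [h1]
  rw [hind.integral_fun_prod_comp (fun p => (hlaw p).aemeasurable)
    (f := fun p (z : ℂ) => Complex.exp (2 * Complex.I * ((w p * z).re : ℝ)))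
    (fun p => Measurable.aestronglyMeasurable (by fun_prop))]
  have h2 : ∀ p, ∫ ω, Complex.exp (2 * Complex.I * ((w p * h p ω).re : ℝ)) ∂μ =
      Complex.exp (-(‖w p‖ ^ 2 : ℝ)) := by
    intro p
    rw [← integral_cexp_re_mul_stdComplexGaussian, ← (hlaw p).map_eq,
      integral_map (hlaw p).aemeasurable (Measurable.aestronglyMeasurable (by fun_prop))]
  simp_rw [h2]
  rw [← Complex.exp_sum]
  congr 1
  push_cast
  rw [Finset.sum_neg_distrib]

/-- Linearization by auxiliary Gaussians: the characteristic function of `CN(0,1)` is itself a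
Gaussian, so a quadratic exponent becomes an average of exponents linear in `a` and `b`. Linear
exponents factor over independent taps, so no joint density is needed, and a degenerate pair causes
no trouble. -/
theorem cexp_neg_norm_sq_eq_integral {t s : ℝ} (ht : 0 ≤ t) (hs : 0 ≤ s) (a b : ℂ) :
    Complex.exp (-(t * ‖a‖ ^ 2 + s * ‖b‖ ^ 2 : ℝ)) =
      ∫ z : ℂ × ℂ, Complex.exp (2 * Complex.I *
        (((Real.sqrt t * z.1) * a + (Real.sqrt s * z.2) * b).re : ℝ))
        ∂(stdComplexGaussian.prod stdComplexGaussian) := by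
  have h1 : ∀ z : ℂ × ℂ, Complex.exp (2 * Complex.I *
        (((Real.sqrt t * z.1) * a + (Real.sqrt s * z.2) * b).re : ℝ)) =
      Complex.exp (2 * Complex.I * (((Real.sqrt t * a) * z.1).re : ℝ)) *
      Complex.exp (2 * Complex.I * (((Real.sqrt s * b) * z.2).re : ℝ)) := by
    intro z
    rw [← Complex.exp_add, Complex.add_re, Complex.ofReal_add, mul_add,
      mul_right_comm _ z.1, mul_right_comm _ z.2]
  simp_rw [h1]
  rw [integral_prod_mul
    (fun z : ℂ => Complex.exp (2 * Complex.I * (((Real.sqrt t * a) * z).re : ℝ)))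
    (fun z : ℂ => Complex.exp (2 * Complex.I * (((Real.sqrt s * b) * z).re : ℝ))),
    integral_cexp_re_mul_stdComplexGaussian, integral_cexp_re_mul_stdComplexGaussian,
    ← Complex.exp_add]
  congr 1
  rw [norm_mul, norm_mul, mul_pow, mul_pow, Complex.norm_real, Complex.norm_real,
    Real.norm_eq_abs, Real.norm_eq_abs, sq_abs, sq_abs, Real.sq_sqrt ht, Real.sq_sqrt hs]
  push_cast
  ring

theorem sum_norm_sq_add_mul {u v : ι → ℂ} (hu : ∑ p, ‖u p‖ ^ 2 = 1) (hv : ∑ p, ‖v p‖ ^ 2 = 1)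
    (z w : ℂ) :
    ∑ p, ‖z * u p + w * v p‖ ^ 2 = ‖z‖ ^ 2 + ‖w‖ ^ 2 +
      2 * (z * (starRingEnd ℂ w * ∑ p, u p * starRingEnd ℂ (v p))).re := by
  have h1 : ∀ p, ‖z * u p + w * v p‖ ^ 2 = ‖z‖ ^ 2 * ‖u p‖ ^ 2 + ‖w‖ ^ 2 * ‖v p‖ ^ 2 +
      2 * (z * (starRingEnd ℂ w * (u p * starRingEnd ℂ (v p)))).re := by
    intro p
    simp only [← Complex.normSq_eq_norm_sq]
    rw [Complex.normSq_add, Complex.normSq_mul, Complex.normSq_mul, map_mul]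
    congr 3
    ring
  simp_rw [h1]
  rw [Finset.sum_add_distrib, Finset.sum_add_distrib, ← Finset.mul_sum, ← Finset.mul_sum, hu, hv,
    ← Finset.mul_sum, ← Complex.re_sum, ← Finset.mul_sum, ← Finset.mul_sum]
  ring

/-- The integral over the auxiliary variables that remains once the taps are averaged out. It is
done one variable at a time by completing the square; `‖c‖ ≤ 1` makes the quadratic form
nonnegative, and equality is allowed. -/
theorem integral_exp_neg_quadratic_prod_stdComplexGaussian {t s : ℝ} (ht : 0 ≤ t) (hs : 0 ≤ s)
    {c : ℂ} (hc : ‖c‖ ≤ 1) :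
    ∫ z : ℂ × ℂ, Complex.exp (-(t * ‖z.1‖ ^ 2 + s * ‖z.2‖ ^ 2 +
      2 * (Real.sqrt t * Real.sqrt s * (z.1 * (starRingEnd ℂ z.2 * c)).re) : ℝ))
      ∂(stdComplexGaussian.prod stdComplexGaussian) =
    1 / ((1 + t) * (1 + s) - ‖c‖ ^ 2 * (t * s) : ℝ) := by
  have hc2 : ‖c‖ ^ 2 ≤ 1 := pow_le_one₀ (norm_nonneg _) hc
  have hint : Integrable (fun z : ℂ × ℂ => Complex.exp (-(t * ‖z.1‖ ^ 2 + s * ‖z.2‖ ^ 2 +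
      2 * (Real.sqrt t * Real.sqrt s * (z.1 * (starRingEnd ℂ z.2 * c)).re) : ℝ)))
      (stdComplexGaussian.prod stdComplexGaussian) := by
    refine Integrable.of_bound (C := 1) (Measurable.aestronglyMeasurable (by fun_prop)) ?_
    refine Filter.Eventually.of_forall fun z => ?_
    rw [← Complex.ofReal_neg, Complex.norm_exp_ofReal, Real.exp_le_one_iff]
    have h1 : |(z.1 * (starRingEnd ℂ z.2 * c)).re| ≤ ‖z.1‖ * ‖z.2‖ := by
      refine (Complex.abs_re_le_norm _).trans ?_
      rw [norm_mul, norm_mul, RCLike.norm_conj, ← mul_assoc]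
      exact mul_le_of_le_one_right (by positivity) hc
    have h2 := (abs_le.1 h1).1
    have h3 : Real.sqrt t * Real.sqrt s * (z.1 * (starRingEnd ℂ z.2 * c)).re ≥
        Real.sqrt t * Real.sqrt s * (-(‖z.1‖ * ‖z.2‖)) :=
      mul_le_mul_of_nonneg_left h2 (by positivity)
    have h4 := sq_nonneg (Real.sqrt t * ‖z.1‖ - Real.sqrt s * ‖z.2‖)
    rw [sub_sq, mul_pow, mul_pow, Real.sq_sqrt ht, Real.sq_sqrt hs] at h4
    linarith
  rw [integral_prod_symm _ hint]
  have h1t : (0 : ℝ) < 1 + t := by linarith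
  have h1t' : (1 + t : ℂ) ≠ 0 := by exact_mod_cast h1t.ne'
  -- The Schur complement: integrating out the first variable leaves `exp (-T ‖w‖²)` in the second.
  set T : ℝ := s - t * s * ‖c‖ ^ 2 / (1 + t) with hTdef
  have hT : 0 ≤ T := by
    rw [hTdef, sub_nonneg, div_le_iff₀ h1t]
    have h5 : t * s * ‖c‖ ^ 2 ≤ t * s := mul_le_of_le_one_right (mul_nonneg ht hs) hc2
    linarith
  have hinner : ∀ w : ℂ, ∫ z : ℂ, Complex.exp (-(t * ‖z‖ ^ 2 + s * ‖w‖ ^ 2 +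
      2 * (Real.sqrt t * Real.sqrt s * (z * (starRingEnd ℂ w * c)).re) : ℝ)) ∂stdComplexGaussian =
      (1 + t : ℂ)⁻¹ * Complex.exp (-(T : ℂ) * (‖w‖ ^ 2 : ℝ) + 2 * (0 * w.re + 0 * w.im)) := by
    intro w
    have h2 : ∀ z : ℂ, Complex.exp (-(t * ‖z‖ ^ 2 + s * ‖w‖ ^ 2 +
      2 * (Real.sqrt t * Real.sqrt s * (z * (starRingEnd ℂ w * c)).re) : ℝ)) =
        Complex.exp (-(s * ‖w‖ ^ 2 : ℝ)) * Complex.exp (-(t : ℂ) * (‖z‖ ^ 2 : ℝ) +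
          2 * ((-(Real.sqrt t * Real.sqrt s * (starRingEnd ℂ w * c).re : ℝ) : ℂ) * z.re +
            ((Real.sqrt t * Real.sqrt s * (starRingEnd ℂ w * c).im : ℝ) : ℂ) * z.im)) := by
      intro z
      rw [← Complex.exp_add, Complex.mul_re z]
      congr 1
      push_cast
      ring
    simp_rw [h2]
    rw [integral_const_mul, integral_cexp_quadratic_stdComplexGaussian ht, mul_div_assoc',
      ← Complex.exp_add, div_eq_inv_mul]
    congr 2
    have h3 : (-(Real.sqrt t * Real.sqrt s * (starRingEnd ℂ w * c).re : ℝ) : ℂ) ^ 2 +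
        ((Real.sqrt t * Real.sqrt s * (starRingEnd ℂ w * c).im : ℝ) : ℂ) ^ 2 =
        (t * s * (‖w‖ ^ 2 * ‖c‖ ^ 2) : ℝ) := by
      have h4 : ‖w‖ ^ 2 * ‖c‖ ^ 2 = (starRingEnd ℂ w * c).re ^ 2 + (starRingEnd ℂ w * c).im ^ 2 := by
        rw [← mul_pow, ← RCLike.norm_conj w, ← norm_mul, ← Complex.normSq_eq_norm_sq,
          Complex.normSq_apply]
        ring
      rw [h4, ← Complex.ofReal_neg, ← Complex.ofReal_pow, ← Complex.ofReal_pow,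
        ← Complex.ofReal_add, neg_sq]
      simp only [mul_pow, Real.sq_sqrt ht, Real.sq_sqrt hs]
      congr 1
      ring
    rw [h3, hTdef]
    push_cast
    field_simp
    ring
  simp_rw [hinner]
  rw [integral_const_mul, integral_cexp_quadratic_stdComplexGaussian hT]
  have h6 : (1 + t) * (1 + s) - ‖c‖ ^ 2 * (t * s) = (1 + t) * (1 + T) := by
    rw [hTdef]
    field_simp
    ring
  rw [h6]
  simp
  ring

theorem norm_sum_mul_conj_le {u v : ι → ℂ} (hu : ∑ p, ‖u p‖ ^ 2 = 1)
    (hv : ∑ p, ‖v p‖ ^ 2 = 1) : ‖∑ p, u p * starRingEnd ℂ (v p)‖ ≤ 1 := by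
  refine (norm_sum_le _ _).trans ?_
  have h1 : ∀ p ∈ Finset.univ, ‖u p * starRingEnd ℂ (v p)‖ ≤ (‖u p‖ ^ 2 + ‖v p‖ ^ 2) / 2 := by
    intro p _
    rw [norm_mul, RCLike.norm_conj]
    linarith [two_mul_le_add_sq ‖u p‖ ‖v p‖]
  refine (Finset.sum_le_sum h1).trans ?_
  rw [← Finset.sum_div, Finset.sum_add_distrib, hu, hv]
  norm_num

/-- After linearization and Fubini, averaging over the taps gives the exponential of minus the
squared norm of `√t z u + √s w v`. Its cross term involves only the inner product of `u` and `v`,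
and the remaining Gaussian integral has been computed above. -/
theorem integral_exp_neg_norm_sq_of_iIndepFun [IsProbabilityMeasure μ] {h : ι → Ω → ℂ}
    (hind : iIndepFun h μ) (hlaw : ∀ p, HasLaw (h p) stdComplexGaussian μ)
    {u v : ι → ℂ} (hu : ∑ p, ‖u p‖ ^ 2 = 1) (hv : ∑ p, ‖v p‖ ^ 2 = 1)
    {t s : ℝ} (ht : 0 ≤ t) (hs : 0 ≤ s) :
    ∫ ω, Real.exp (-(t * ‖∑ p, u p * h p ω‖ ^ 2 + s * ‖∑ p, v p * h p ω‖ ^ 2)) ∂μ =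
      1 / ((1 + t) * (1 + s) - ‖∑ p, u p * starRingEnd ℂ (v p)‖ ^ 2 * (t * s)) := by
  have hm : ∀ p, AEMeasurable (h p) μ := fun p => (hlaw p).aemeasurable
  have hm' : ∀ p, AEMeasurable (fun x : Ω × ℂ × ℂ => h p x.1)
      (μ.prod (stdComplexGaussian.prod stdComplexGaussian)) := fun p => (hm p).comp_fst
  rw [← Complex.ofReal_inj, ← integral_complex_ofReal]
  simp_rw [Complex.ofReal_exp, Complex.ofReal_neg, cexp_neg_norm_sq_eq_integral ht hs]
  -- The integrand has modulus one, so Fubini holds on the product of probability spaces.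
  rw [integral_integral_swap]
  · have h1 : ∀ (z : ℂ × ℂ) (ω : Ω), (Real.sqrt t * z.1) * (∑ p, u p * h p ω) +
        (Real.sqrt s * z.2) * (∑ p, v p * h p ω) =
        ∑ p, ((Real.sqrt t * z.1) * u p + (Real.sqrt s * z.2) * v p) * h p ω := by
      intro z ω
      rw [Finset.mul_sum, Finset.mul_sum, ← Finset.sum_add_distrib]
      refine Finset.sum_congr rfl fun p _ => ?_
      ring
    simp_rw [h1, integral_cexp_re_sum_of_iIndepFun hind hlaw, sum_norm_sq_add_mul hu hv]
    have h2 := integral_exp_neg_quadratic_prod_stdComplexGaussian ht hs (norm_sum_mul_conj_le hu hv)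
    push_cast at h2 ⊢
    rw [← h2]
    refine integral_congr_ae (Filter.Eventually.of_forall fun z => ?_)
    beta_reduce
    have h3 : (Real.sqrt t * z.1 * (starRingEnd ℂ (Real.sqrt s * z.2) *
        ∑ p, u p * starRingEnd ℂ (v p))).re = Real.sqrt t * Real.sqrt s *
          (z.1 * (starRingEnd ℂ z.2 * ∑ p, u p * starRingEnd ℂ (v p))).re := by
      rw [map_mul, Complex.conj_ofReal, ← Complex.re_ofReal_mul]
      congr 1
      push_cast
      ring
    rw [h3, norm_mul, norm_mul, Complex.norm_real, Complex.norm_real,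
      Real.norm_eq_abs, Real.norm_eq_abs, abs_of_nonneg (Real.sqrt_nonneg _),
      abs_of_nonneg (Real.sqrt_nonneg _)]
    congr 2
    norm_cast
    rw [mul_pow, mul_pow, Real.sq_sqrt ht, Real.sq_sqrt hs]
  · refine Integrable.of_bound (C := 1) ?_ ?_
    · simp only [Function.uncurry_def]
      refine AEMeasurable.aestronglyMeasurable ?_
      have h4 : ∀ w : ι → ℂ, AEMeasurable (fun x : Ω × ℂ × ℂ => ∑ p, w p * h p x.1)
          (μ.prod (stdComplexGaussian.prod stdComplexGaussian)) := fun w =>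
        Finset.aemeasurable_fun_sum _ fun p _ => (hm' p).const_mul _
      have h5 := h4 u
      have h6 := h4 v
      fun_prop
    · refine Filter.Eventually.of_forall fun x => ?_
      simp only [Function.uncurry_def]
      rw [mul_right_comm, ← Complex.ofReal_ofNat, ← Complex.ofReal_mul,
        Complex.norm_exp_ofReal_mul_I]

end JointLaplaceTransform

/-! ### Logarithms as Laplace integrals, and their covariance -/

/-- Tonelli applied to `e^{-(ε+x)t}` on `0 < x ≤ a`, `t > 0`: the `x`-integral gives the integrand
on the right, while the `t`-integral gives `1/(ε+x)`, whose primitive is a logarithm. -/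
theorem ofReal_log_one_add_div_eq_lintegral {ε a : ℝ} (hε : 0 < ε) (ha : 0 ≤ a) :
    ENNReal.ofReal (Real.log (1 + a / ε)) = ∫⁻ t in Set.Ioi (0 : ℝ),
      ENNReal.ofReal (Real.exp (-(ε * t)) * (1 - Real.exp (-(t * a))) / t) := by
  have h1 : ∀ t ∈ Set.Ioi (0 : ℝ),
      ENNReal.ofReal (Real.exp (-(ε * t)) * (1 - Real.exp (-(t * a))) / t) =
      ∫⁻ x in Set.Ioc 0 a, ENNReal.ofReal (Real.exp (-(ε + x) * t)) := by
    intro t ht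
    have ht0 : t ≠ 0 := (Set.mem_Ioi.1 ht).ne'
    rw [← ofReal_integral_eq_lintegral_ofReal
      ((Continuous.integrableOn_Icc (by fun_prop)).mono_set Set.Ioc_subset_Icc_self)
      (Filter.Eventually.of_forall fun x => (Real.exp_pos _).le),
      ← intervalIntegral.integral_of_le ha]
    congr 1
    have hd : ∀ x ∈ Set.uIcc 0 a, HasDerivAt (fun x => -Real.exp (-(ε + x) * t) / t)
        (Real.exp (-(ε + x) * t)) x := by
      intro x _
      have h := ((((hasDerivAt_id x).const_add ε).neg.mul_const t).exp.neg).div_const t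
      refine h.congr_deriv ?_
      simp only [id, Pi.neg_apply]
      rw [neg_one_mul, mul_neg, neg_neg, mul_div_assoc, div_self ht0, mul_one]
    rw [intervalIntegral.integral_eq_sub_of_hasDerivAt hd
      (Continuous.intervalIntegrable (by fun_prop) _ _)]
    rw [mul_sub, mul_one, ← Real.exp_add]
    ring_nf
  have h2 : ∀ x ∈ Set.Ioc 0 a, ∫⁻ t in Set.Ioi (0 : ℝ),
      ENNReal.ofReal (Real.exp (-(ε + x) * t)) = ENNReal.ofReal (1 / (ε + x)) := by
    intro x hx
    have hx0 : 0 < ε + x := by linarith [hx.1]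
    rw [← ofReal_integral_eq_lintegral_ofReal (integrableOn_exp_mul_Ioi (by linarith) 0)
      (Filter.Eventually.of_forall fun x => (Real.exp_pos _).le),
      integral_exp_mul_Ioi (by linarith)]
    congr 1
    rw [mul_zero, Real.exp_zero, neg_div_neg_eq]
  rw [setLIntegral_congr_fun measurableSet_Ioi h1, lintegral_lintegral_swap
    (Measurable.aemeasurable (by unfold Function.uncurry; fun_prop)),
    setLIntegral_congr_fun measurableSet_Ioc h2]
  have hc : ContinuousOn (fun x : ℝ => 1 / (ε + x)) (Set.Icc 0 a) := by
    refine ContinuousOn.div (by fun_prop) (by fun_prop) fun x hx => ?_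
    have := hx.1
    linarith
  rw [← ofReal_integral_eq_lintegral_ofReal (hc.integrableOn_Icc.mono_set Set.Ioc_subset_Icc_self)
    ((ae_restrict_iff' measurableSet_Ioc).2 (Filter.Eventually.of_forall fun x hx => by
      have := hx.1
      simp only [Pi.zero_apply]
      positivity)),
    ← intervalIntegral.integral_of_le ha]
  congr 1
  have hd : ∀ x ∈ Set.uIcc 0 a, HasDerivAt (fun x => Real.log (ε + x)) (1 / (ε + x)) x := by
    intro x hx
    rw [Set.uIcc_of_le ha] at hx
    have := hx.1
    exact ((hasDerivAt_id x).const_add ε).log (by simp only [id]; linarith)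
  rw [intervalIntegral.integral_eq_sub_of_hasDerivAt hd, add_zero, ← Real.log_div (by linarith)
    (by linarith)]
  · congr 1
    field_simp
  · rw [intervalIntegrable_iff_integrableOn_Icc_of_le ha]
    exact hc.integrableOn_Icc

/-- The kernel whose integral over the quadrant is the limiting covariance of the logarithms of two
unit-mean exponential variables with squared correlation `r`. -/
noncomputable def covKernel (r t s : ℝ) : ℝ :=
  r / ((1 + t) * (1 + s) * ((1 + t) * (1 + s) - r * (t * s)))

theorem one_le_laplace_denom {r t s : ℝ} (hr : r ≤ 1) (ht : 0 ≤ t) (hs : 0 ≤ s) :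
    1 ≤ (1 + t) * (1 + s) - r * (t * s) := by
  have := mul_le_mul_of_nonneg_right hr (mul_nonneg ht hs)
  linarith

theorem covKernel_nonneg {r t s : ℝ} (hr0 : 0 ≤ r) (hr : r ≤ 1) (ht : 0 ≤ t) (hs : 0 ≤ s) :
    0 ≤ covKernel r t s := by
  have := one_le_laplace_denom hr ht hs
  unfold covKernel
  positivity

/-- The covariance identity in additive form. With values in `[0, ∞]`, Tonelli applies without prior
integrability and no subtraction occurs. Pointwise in `(t, s)` it rests on `1/D - 1/((1+t)(1+s)) = r
t s / ((1+t)(1+s) D)` with `D = (1+t)(1+s) - r t s`. -/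
theorem lintegral_mul_log_eq_add [IsProbabilityMeasure μ] {A B : Ω → ℝ} (hA : AEMeasurable A μ)
    (hB : AEMeasurable B μ) (hA0 : ∀ ω, 0 ≤ A ω) (hB0 : ∀ ω, 0 ≤ B ω) {r : ℝ} (hr0 : 0 ≤ r)
    (hr : r ≤ 1)
    (hlap : ∀ t s : ℝ, 0 ≤ t → 0 ≤ s → ∫ ω, Real.exp (-(t * A ω + s * B ω)) ∂μ =
      1 / ((1 + t) * (1 + s) - r * (t * s))) {ε : ℝ} (hε : 0 < ε) :
    ∫⁻ ω, ENNReal.ofReal (Real.log (1 + A ω / ε)) * ENNReal.ofReal (Real.log (1 + B ω / ε)) ∂μ =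
      (∫⁻ ω, ENNReal.ofReal (Real.log (1 + A ω / ε)) ∂μ) *
        (∫⁻ ω, ENNReal.ofReal (Real.log (1 + B ω / ε)) ∂μ) +
      ∫⁻ z, ENNReal.ofReal (Real.exp (-(ε * (z.1 + z.2))) * covKernel r z.1 z.2)
        ∂((volume.restrict (Set.Ioi (0 : ℝ))).prod (volume.restrict (Set.Ioi (0 : ℝ)))) := by
  have hexp : ∀ t s : ℝ, 0 ≤ t → 0 ≤ s →
      Integrable (fun ω => Real.exp (-(t * A ω + s * B ω))) μ := by
    intro t s ht hs
    refine Integrable.of_bound (C := 1) (AEMeasurable.aestronglyMeasurable (by fun_prop)) ?_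
    refine Filter.Eventually.of_forall fun ω => ?_
    rw [Real.norm_eq_abs, Real.abs_exp, Real.exp_le_one_iff]
    have := mul_nonneg ht (hA0 ω)
    have := mul_nonneg hs (hB0 ω)
    linarith
  set ν : Measure ℝ := volume.restrict (Set.Ioi (0 : ℝ)) with hν
  set g : ℝ → ℝ → ℝ := fun t a => Real.exp (-(ε * t)) * (1 - Real.exp (-(t * a))) / t with hg
  have hg0 : ∀ t a, 0 < t → 0 ≤ a → 0 ≤ g t a := by
    intro t a ht ha
    have : Real.exp (-(t * a)) ≤ 1 := Real.exp_le_one_iff.2 (by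
      have := mul_nonneg ht.le ha
      linarith)
    exact div_nonneg (mul_nonneg (Real.exp_pos _).le (by linarith)) ht.le
  have hgm : Measurable (fun p : ℝ × ℝ => g p.1 p.2) := by
    simp only [hg]
    fun_prop
  have hlog : ∀ a, 0 ≤ a → ENNReal.ofReal (Real.log (1 + a / ε)) =
      ∫⁻ t, ENNReal.ofReal (g t a) ∂ν := fun a ha => ofReal_log_one_add_div_eq_lintegral hε ha
  simp_rw [hlog _ (hA0 _), hlog _ (hB0 _)]
  have hswap : ∀ C : Ω → ℝ, AEMeasurable C μ → ∫⁻ ω, ∫⁻ t, ENNReal.ofReal (g t (C ω)) ∂ν ∂μ =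
      ∫⁻ t, ∫⁻ ω, ENNReal.ofReal (g t (C ω)) ∂μ ∂ν := by
    intro C hC
    refine lintegral_lintegral_swap ?_
    have h1 : AEMeasurable (fun p : Ω × ℝ => (p.2, C p.1)) (μ.prod ν) :=
      measurable_snd.aemeasurable.prodMk hC.comp_fst
    exact (hgm.comp_aemeasurable h1).ennreal_ofReal
  rw [hswap A hA, hswap B hB]
  have hmeas : ∀ C : Ω → ℝ, AEMeasurable C μ →
      AEMeasurable (fun t => ∫⁻ ω, ENNReal.ofReal (g t (C ω)) ∂μ) ν := by
    intro C hC
    refine AEMeasurable.lintegral_prod_right' (f := fun p : ℝ × Ω => ENNReal.ofReal (g p.1 (C p.2)))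
      ?_
    have h1 : AEMeasurable (fun p : ℝ × Ω => (p.1, C p.2)) (ν.prod μ) :=
      measurable_fst.aemeasurable.prodMk hC.comp_snd
    exact (hgm.comp_aemeasurable h1).ennreal_ofReal
  rw [← lintegral_prod_mul (hmeas A hA) (hmeas B hB), ← lintegral_add_left' ?_]
  swap
  · exact (hmeas A hA).comp_fst.mul (hmeas B hB).comp_snd
  have hprod : ∀ ω, (∫⁻ t, ENNReal.ofReal (g t (A ω)) ∂ν) * (∫⁻ t, ENNReal.ofReal (g t (B ω)) ∂ν) =
      ∫⁻ z, ENNReal.ofReal (g z.1 (A ω)) * ENNReal.ofReal (g z.2 (B ω)) ∂(ν.prod ν) := by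
    intro ω
    rw [lintegral_prod_mul (f := fun t => ENNReal.ofReal (g t (A ω)))
      (g := fun t => ENNReal.ofReal (g t (B ω)))]
    · exact (hgm.comp (measurable_id.prodMk measurable_const)).ennreal_ofReal.aemeasurable
    · exact (hgm.comp (measurable_id.prodMk measurable_const)).ennreal_ofReal.aemeasurable
  simp_rw [hprod]
  rw [lintegral_lintegral_swap]
  swap
  · have h1 : AEMeasurable (fun p : Ω × ℝ × ℝ => (p.2.1, A p.1)) (μ.prod (ν.prod ν)) :=
      (measurable_fst.comp measurable_snd).aemeasurable.prodMk hA.comp_fst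
    have h2 : AEMeasurable (fun p : Ω × ℝ × ℝ => (p.2.2, B p.1)) (μ.prod (ν.prod ν)) :=
      (measurable_snd.comp measurable_snd).aemeasurable.prodMk hB.comp_fst
    exact (hgm.comp_aemeasurable h1).ennreal_ofReal.mul (hgm.comp_aemeasurable h2).ennreal_ofReal
  have hpos : ∀ᵐ z ∂(ν.prod ν), 0 < z.1 ∧ 0 < z.2 := by
    rw [hν, Measure.prod_restrict]
    exact ae_restrict_of_forall_mem (measurableSet_Ioi.prod measurableSet_Ioi) fun z hz => hz
  refine lintegral_congr_ae ?_
  filter_upwards [hpos] with z hz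
  obtain ⟨ht, hs⟩ := hz
  generalize z.1 = t at *
  generalize z.2 = s at *
  -- The zero coefficient lets the joint transform supply the marginal ones as well.
  have eA : ∀ ω, Real.exp (-(t * A ω)) = Real.exp (-(t * A ω + 0 * B ω)) := fun ω => by simp
  have eB : ∀ ω, Real.exp (-(s * B ω)) = Real.exp (-(0 * A ω + s * B ω)) := fun ω => by simp
  have gA : ∀ ω, g t (A ω) = Real.exp (-(ε * t)) / t -
      Real.exp (-(ε * t)) / t * Real.exp (-(t * A ω + 0 * B ω)) := by
    intro ω
    simp only [hg]
    rw [eA]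
    ring
  have gB : ∀ ω, g s (B ω) = Real.exp (-(ε * s)) / s -
      Real.exp (-(ε * s)) / s * Real.exp (-(0 * A ω + s * B ω)) := by
    intro ω
    simp only [hg]
    rw [eB]
    ring
  have iA : Integrable (fun ω => g t (A ω)) μ := by
    simp_rw [gA]
    exact (integrable_const _).sub ((hexp t 0 ht.le le_rfl).const_mul _)
  have iB : Integrable (fun ω => g s (B ω)) μ := by
    simp_rw [gB]
    exact (integrable_const _).sub ((hexp 0 s le_rfl hs.le).const_mul _)
  have gAB : ∀ ω, g t (A ω) * g s (B ω) = Real.exp (-(ε * t)) / t * g s (B ω) -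
      Real.exp (-(ε * t)) / t * (Real.exp (-(ε * s)) / s) *
        (Real.exp (-(t * A ω + 0 * B ω)) - Real.exp (-(t * A ω + s * B ω))) := by
    intro ω
    have : Real.exp (-(t * A ω + s * B ω)) =
      Real.exp (-(t * A ω + 0 * B ω)) * Real.exp (-(0 * A ω + s * B ω)) := by
      rw [← Real.exp_add]
      ring_nf
    rw [gA, gB, this]
    ring
  have iAB1 : Integrable (fun ω => Real.exp (-(t * A ω + 0 * B ω)) -
      Real.exp (-(t * A ω + s * B ω))) μ :=
    (hexp t 0 ht.le le_rfl).sub (hexp t s ht.le hs.le)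
  have iAB : Integrable (fun ω => g t (A ω) * g s (B ω)) μ := by
    simp_rw [gAB]
    exact (iB.const_mul _).sub (iAB1.const_mul _)
  simp_rw [← ENNReal.ofReal_mul (hg0 _ _ ht (hA0 _))]
  rw [← ofReal_integral_eq_lintegral_ofReal iAB (Filter.Eventually.of_forall fun ω =>
      mul_nonneg (hg0 _ _ ht (hA0 _)) (hg0 _ _ hs (hB0 _))),
    ← ofReal_integral_eq_lintegral_ofReal iA (Filter.Eventually.of_forall fun ω =>
      hg0 _ _ ht (hA0 _)),
    ← ofReal_integral_eq_lintegral_ofReal iB (Filter.Eventually.of_forall fun ω =>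
      hg0 _ _ hs (hB0 _)),
    ← ENNReal.ofReal_mul (integral_nonneg fun ω => hg0 _ _ ht (hA0 _)),
    ← ENNReal.ofReal_add
      (mul_nonneg (integral_nonneg fun ω => hg0 _ _ ht (hA0 _))
        (integral_nonneg fun ω => hg0 _ _ hs (hB0 _)))
      (mul_nonneg (Real.exp_pos _).le (covKernel_nonneg hr0 hr ht.le hs.le))]
  congr 1
  have vA : ∫ ω, g t (A ω) ∂μ = Real.exp (-(ε * t)) / (1 + t) := by
    simp_rw [gA]
    rw [integral_sub (integrable_const _) ((hexp t 0 ht.le le_rfl).const_mul _),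
      integral_const_mul, hlap t 0 ht.le le_rfl]
    simp
    field_simp
    ring
  have vB : ∫ ω, g s (B ω) ∂μ = Real.exp (-(ε * s)) / (1 + s) := by
    simp_rw [gB]
    rw [integral_sub (integrable_const _) ((hexp 0 s le_rfl hs.le).const_mul _),
      integral_const_mul, hlap 0 s le_rfl hs.le]
    simp
    field_simp
    ring
  have vAB : ∫ ω, g t (A ω) * g s (B ω) ∂μ = Real.exp (-(ε * t)) / t *
      (Real.exp (-(ε * s)) / (1 + s)) - Real.exp (-(ε * t)) / t * (Real.exp (-(ε * s)) / s) *
        (1 / ((1 + t) * (1 + 0) - r * (t * 0)) - 1 / ((1 + t) * (1 + s) - r * (t * s))) := by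
    simp_rw [gAB]
    rw [integral_sub (iB.const_mul _) (iAB1.const_mul _), integral_const_mul, integral_const_mul,
      integral_sub (hexp t 0 ht.le le_rfl) (hexp t s ht.le hs.le), hlap _ _ ht.le le_rfl,
      hlap _ _ ht.le hs.le, vB]
  rw [vA, vB, vAB, covKernel, mul_add ε, neg_add, Real.exp_add]
  have hD : (1 + t) * (1 + s) - r * (t * s) ≠ 0 := by
    linarith [one_le_laplace_denom hr ht.le hs.le]
  have h1t : 1 + t ≠ 0 := by linarith
  have h1s : 1 + s ≠ 0 := by linarith
  simp only [mul_zero, sub_zero, add_zero, mul_one]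
  -- The denominator is kept as an atom while fractions are cleared, and expanded only for the final
  -- polynomial identity.
  obtain ⟨D, hDdef⟩ : ∃ D, D = (1 + t) * (1 + s) - r * (t * s) := ⟨_, rfl⟩
  rw [← hDdef] at hD ⊢
  field_simp
  rw [hDdef]
  ring

/-! ### The dilogarithm on `[0, 1]` -/

open Set Filter Topology

/-- An integrable majorant near both endpoints: for `t ≤ 1/2` the denominator is at least `1/2` in
modulus, and for `t > 1/2` one has `|log t| ≤ 2|t - 1|`. -/
theorem abs_log_div_sub_one_le {t : ℝ} (ht0 : 0 < t) :
    |Real.log t / (t - 1)| ≤ 2 * |Real.log t| + 2 := by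
  rcases le_or_gt t (1 / 2) with h | h
  · rw [abs_div, abs_of_nonpos (by linarith : t - 1 ≤ 0), div_le_iff₀ (by linarith)]
    nlinarith [abs_nonneg (Real.log t)]
  · have h1 : |Real.log t| ≤ 2 * |t - 1| := by
      have h2 := Real.log_le_sub_one_of_pos ht0
      have h3 := Real.one_sub_inv_le_log_of_pos ht0
      have h4 : 1 - t⁻¹ = t⁻¹ * (t - 1) := by
        rw [mul_sub, inv_mul_cancel₀ ht0.ne', mul_one]
      have h5 : t⁻¹ ≤ 2 := by
        rw [inv_le_comm₀ ht0 (by norm_num)]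
        linarith
      have h6 : 0 < t⁻¹ := inv_pos.2 ht0
      rw [abs_le]
      constructor
      · have : t⁻¹ * (t - 1) ≥ -(2 * |t - 1|) := by
          have h7 := neg_abs_le (t - 1)
          have h8 := mul_le_mul_of_nonneg_right h5 (abs_nonneg (t - 1))
          have h9 := mul_le_mul_of_nonneg_left h7 h6.le
          linarith
        linarith
      · linarith [le_abs_self (t - 1), abs_nonneg (t - 1)]
    have h2 : |Real.log t / (t - 1)| ≤ 2 := by
      rw [abs_div]
      exact div_le_of_le_mul₀ (abs_nonneg _) (by norm_num) h1
    linarith [abs_nonneg (Real.log t)]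

theorem intervalIntegrable_log_div_sub_one :
    IntervalIntegrable (fun t : ℝ => Real.log t / (t - 1)) volume 0 1 := by
  have h : IntervalIntegrable (fun t : ℝ => 2 * |Real.log t| + 2) volume 0 1 :=
    (intervalIntegral.intervalIntegrable_log'.abs.const_mul 2).add intervalIntegrable_const
  refine h.mono_fun' (Measurable.aestronglyMeasurable (by fun_prop)) ?_
  rw [uIoc_of_le zero_le_one]
  exact ae_restrict_of_forall_mem measurableSet_Ioc fun t ht => abs_log_div_sub_one_le ht.1

theorem continuousOn_dilog : ContinuousOn dilog (Icc 0 1) := by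
  have h := intervalIntegral.continuousOn_primitive_interval_left
    (μ := volume) (f := fun t : ℝ => Real.log t / (t - 1)) (a := 0) (b := 1)
    (by rw [uIcc_of_le zero_le_one, integrableOn_Icc_iff_integrableOn_Ioc,
          ← intervalIntegrable_iff_integrableOn_Ioc_of_le zero_le_one]
        exact intervalIntegrable_log_div_sub_one)
  rw [uIcc_of_le zero_le_one] at h
  refine h.congr fun x _ => ?_
  rw [dilog, intervalIntegral.integral_symm, neg_neg]

/-- The point `1` is excluded because the integrand takes the default value `0` there, while its
limit is `1`. Later arguments reach the endpoints by continuity. -/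
theorem hasDerivAt_dilog {x : ℝ} (h0 : 0 < x) (h1 : x < 1) :
    HasDerivAt dilog (-(Real.log x / (x - 1))) x := by
  refine HasDerivAt.fun_neg ?_
  refine intervalIntegral.integral_hasDerivAt_right ?_ ?_ ?_
  · refine (intervalIntegrable_log_div_sub_one.mono_set ?_).symm
    rw [uIcc_of_le h1.le, uIcc_of_le zero_le_one]
    exact Icc_subset_Icc_left h0.le
  · exact (Measurable.stronglyMeasurable (by fun_prop)).stronglyMeasurableAtFilter
  · exact ContinuousAt.div (Real.continuousAt_log h0.ne') (by fun_prop) (by linarith)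

theorem dilog_one : dilog 1 = 0 := by simp [dilog]

theorem hasDerivAt_log_affine_ratio {a b s : ℝ} (ha : 0 < a) (hb : 0 ≤ b) (hs : 0 ≤ s) :
    HasDerivAt (fun s => Real.log ((1 + s) / (a + b * s)))
      ((a - b) / ((1 + s) * (a + b * s))) s := by
  have h1 : 0 < 1 + s := by linarith
  have h2 : 0 < a + b * s := by positivity
  have hd1 : HasDerivAt (fun s : ℝ => 1 + s) 1 s := (hasDerivAt_id s).const_add 1
  have hd2 : HasDerivAt (fun s : ℝ => a + b * s) b s := by
    simpa using ((hasDerivAt_id s).const_mul b).const_add a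
  refine ((hd1.div hd2 h2.ne').log (div_pos h1 h2).ne').congr_deriv ?_
  simp only [Pi.div_apply]
  field_simp
  ring

theorem dilog_nonneg {x : ℝ} (h0 : 0 ≤ x) (h1 : x ≤ 1) : 0 ≤ dilog x := by
  rw [dilog, intervalIntegral.integral_symm, neg_neg]
  refine intervalIntegral.integral_nonneg h1 fun t ht => ?_
  exact div_nonneg_of_nonpos (Real.log_nonpos (h0.trans ht.1) ht.2) (by linarith [ht.2])

theorem integral_neg_log_mul_pow (n : ℕ) :
    ∫ t in (0 : ℝ)..1, -Real.log t * t ^ n = 1 / ((n : ℝ) + 1) ^ 2 := by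
  have hn : ((n : ℝ) + 1) ≠ 0 := by positivity
  have h := intervalIntegral.integral_eq_sub_of_hasDerivAt_of_le (a := (0 : ℝ)) (b := 1)
    -- Integration by parts gives this primitive; grouping `t * log t` makes its continuity at `0`
    -- visible.
    (f := fun t => t ^ (n + 1) / ((n : ℝ) + 1) ^ 2 - t * Real.log t * t ^ n / ((n : ℝ) + 1))
    (f' := fun t => -Real.log t * t ^ n) zero_le_one ?_ ?_ ?_
  · rw [h]
    simp
  · have := Real.continuous_mul_log
    exact Continuous.continuousOn (by fun_prop)
  · intro t ht
    have ht0 : t ≠ 0 := ht.1.ne'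
    have h1 := (((hasDerivAt_pow (n + 1) t).div_const (((n : ℝ) + 1) ^ 2))).sub
      (((Real.hasDerivAt_log ht0).mul (hasDerivAt_pow (n + 1) t)).div_const ((n : ℝ) + 1))
    have h2 : (fun t : ℝ => t ^ (n + 1) / ((n : ℝ) + 1) ^ 2 - t * Real.log t * t ^ n / ((n : ℝ) + 1))
        = (fun t : ℝ => t ^ (n + 1) / ((n : ℝ) + 1) ^ 2) -
          fun t : ℝ => (Real.log * fun t : ℝ => t ^ (n + 1) : ℝ → ℝ) t / ((n : ℝ) + 1) := by
      ext t
      simp only [Pi.sub_apply, Pi.mul_apply]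
      ring
    rw [h2]
    refine h1.congr_deriv ?_
    simp only [Nat.add_sub_cancel]
    push_cast
    field_simp
    ring
  · exact intervalIntegral.intervalIntegrable_log'.neg.mul_continuousOn (by fun_prop)

/-- Expanding `1/(1-t)` as a geometric series and integrating termwise reduces the value to the
Basel sum. -/
theorem dilog_zero : dilog 0 = Real.pi ^ 2 / 6 := by
  rw [dilog, intervalIntegral.integral_symm, neg_neg]
  have hint : ∀ n : ℕ, IntervalIntegrable (fun t : ℝ => -Real.log t * t ^ n) volume 0 1 :=
    fun n => intervalIntegral.intervalIntegrable_log'.neg.mul_continuousOn (by fun_prop)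
  have hz : HasSum (fun n : ℕ => 1 / ((n : ℝ) + 1) ^ 2) (Real.pi ^ 2 / 6) := by
    have h := (hasSum_nat_add_iff' 1).2 hasSum_zeta_two
    simpa using h
  have hs := hasSum_integral_of_summable_integral_norm
    (μ := volume.restrict (Ioc (0 : ℝ) 1)) (F := fun (n : ℕ) (t : ℝ) => -Real.log t * t ^ n)
    (fun n => (intervalIntegrable_iff_integrableOn_Ioc_of_le zero_le_one).1 (hint n)) ?_
  · simp_rw [← intervalIntegral.integral_of_le zero_le_one, integral_neg_log_mul_pow] at hs
    refine Eq.trans ?_ (hs.unique hz)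
    -- The endpoint `t = 1` is dropped, since the geometric series formula needs `t < 1`.
    rw [intervalIntegral.integral_of_le zero_le_one, intervalIntegral.integral_of_le zero_le_one,
      ← integral_Ioc_eq_integral_Ioo.symm, integral_Ioc_eq_integral_Ioo]
    refine setIntegral_congr_fun measurableSet_Ioo fun t ht => ?_
    rw [tsum_mul_left, tsum_geometric_of_lt_one ht.1.le ht.2, ← div_eq_mul_inv, ← neg_sub t 1,
      div_neg, neg_div, neg_neg]
  · have h1 : ∀ n : ℕ, ∫ t in Ioc (0 : ℝ) 1, ‖-Real.log t * t ^ n‖ = 1 / ((n : ℝ) + 1) ^ 2 := by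
      intro n
      rw [← integral_neg_log_mul_pow, intervalIntegral.integral_of_le zero_le_one]
      refine setIntegral_congr_fun measurableSet_Ioc fun t ht => ?_
      exact Real.norm_of_nonneg (mul_nonneg (neg_nonneg.2 (Real.log_nonpos ht.1.le ht.2))
        (pow_nonneg ht.1.le _))
    simp_rw [h1]
    exact hz.summable

/-! ### Integral of the covariance kernel -/

theorem lintegral_covKernel_right {r t : ℝ} (hr0 : 0 ≤ r) (hr : r ≤ 1) (ht : 0 < t) :
    ∫⁻ s in Ioi (0 : ℝ), ENNReal.ofReal (covKernel r t s) =
      ENNReal.ofReal (-Real.log (1 - r * (t / (1 + t))) / (t * (1 + t))) := by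
  have ha : 0 < 1 + t := by linarith
  have hb : 0 < 1 + t - r * t := by nlinarith
  -- Partial fractions in `s`: the denominator `D` is affine, `a + b s` with `a = 1 + t` and `b = 1
  -- + t - r t`, and `a - b = r t`.
  set G : ℝ → ℝ := fun s => Real.log ((1 + s) / (1 + t + (1 + t - r * t) * s)) / (t * (1 + t))
  have hd : ∀ s ∈ Ici (0 : ℝ), HasDerivAt G (covKernel r t s) s := by
    intro s hs
    have hs0 : 0 ≤ s := hs
    refine ((hasDerivAt_log_affine_ratio ha hb.le hs).div_const (t * (1 + t))).congr_deriv ?_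
    have e1 : (1 + t) * (1 + s) - r * (t * s) = 1 + t + (1 + t - r * t) * s := by ring
    have hp : 0 < 1 + t + (1 + t - r * t) * s := by positivity
    rw [covKernel, e1]
    obtain ⟨D, hD⟩ : ∃ D, D = 1 + t + (1 + t - r * t) * s := ⟨_, rfl⟩
    rw [← hD] at hp ⊢
    have : 0 < 1 + s := by linarith
    field_simp
    ring
  have h0 : ∀ s ∈ Ioi (0 : ℝ), 0 ≤ covKernel r t s := fun s hs =>
    covKernel_nonneg hr0 hr ht.le (le_of_lt hs)
  have hlim : Tendsto G atTop (𝓝 (Real.log (1 / (1 + t - r * t)) / (t * (1 + t)))) := by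
    refine Tendsto.div_const (Tendsto.log ?_ (by positivity)) _
    -- Polynomial division: `(1+s)/(a+bs) = 1/b + (1 - a/b)/(a+bs)`.
    have h1 : Tendsto (fun s : ℝ => 1 / (1 + t - r * t) + (1 - (1 + t) / (1 + t - r * t)) *
        (1 + t + (1 + t - r * t) * s)⁻¹) atTop (𝓝 (1 / (1 + t - r * t) +
          (1 - (1 + t) / (1 + t - r * t)) * 0)) := by
      refine tendsto_const_nhds.add (Tendsto.const_mul _ (tendsto_inv_atTop_zero.comp ?_))
      exact tendsto_atTop_add_const_left _ _ (tendsto_id.const_mul_atTop hb)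
    rw [mul_zero, add_zero] at h1
    refine h1.congr' ?_
    filter_upwards [eventually_ge_atTop 0] with s hs
    have hp : 0 < 1 + t + (1 + t - r * t) * s := by positivity
    obtain ⟨D, hD⟩ : ∃ D, D = 1 + t + (1 + t - r * t) * s := ⟨_, rfl⟩
    obtain ⟨b, hb'⟩ : ∃ b, b = 1 + t - r * t := ⟨_, rfl⟩
    rw [← hD] at hp ⊢
    rw [← hb'] at hb hD ⊢
    field_simp
    rw [hD]
    ring
  rw [← ofReal_integral_eq_lintegral_ofReal (integrableOn_Ioi_deriv_of_nonneg' hd h0 hlim)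
    (ae_restrict_of_forall_mem measurableSet_Ioi h0),
    integral_Ioi_of_hasDerivAt_of_nonneg' hd h0 hlim]
  congr 1
  simp only [G]
  have e2 : 1 - r * (t / (1 + t)) = (1 + t - r * t) / (1 + t) := by
    field_simp
  rw [e2, add_zero, mul_zero, add_zero, Real.log_div hb.ne' ha.ne', one_div, one_div,
    Real.log_inv, Real.log_inv]
  ring

theorem measurable_covKernel (r : ℝ) : Measurable fun z : ℝ × ℝ => covKernel r z.1 z.2 := by
  unfold covKernel
  fun_prop

/-- With `x = r t/(1+t)` one has `dx/x = dt/(t(1+t))`, so the remaining integrand is the derivative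
of `dilog (1 - x)`, and `x` runs from `0` to `r`. -/
theorem lintegral_covKernel {r : ℝ} (hr0 : 0 ≤ r) (hr : r ≤ 1) :
    ∫⁻ z, ENNReal.ofReal (covKernel r z.1 z.2)
      ∂((volume.restrict (Ioi (0 : ℝ))).prod (volume.restrict (Ioi (0 : ℝ)))) =
      ENNReal.ofReal (dilog (1 - r)) := by
  -- For `r = 0` the argument of `dilog` would stay at `1`, where the derivative formula is not
  -- available; the kernel then vanishes.
  rcases hr0.eq_or_lt with rfl | hr0'
  · simp [covKernel, dilog_one]
  rw [lintegral_prod _ (measurable_covKernel r).ennreal_ofReal.aemeasurable,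
    setLIntegral_congr_fun measurableSet_Ioi fun t ht => lintegral_covKernel_right hr0 hr ht]
  have hx : ∀ t : ℝ, 0 < t → 0 < t / (1 + t) ∧ t / (1 + t) < 1 := by
    intro t ht
    refine ⟨by positivity, ?_⟩
    rw [div_lt_one (by linarith)]
    linarith
  have hmem : ∀ t : ℝ, 0 ≤ t → 1 - r * (t / (1 + t)) ∈ Icc (0 : ℝ) 1 := by
    intro t ht
    have h1 : 0 ≤ t / (1 + t) := by positivity
    have h2 : t / (1 + t) ≤ 1 := div_le_one_of_le₀ (by linarith) (by linarith)
    have h3 := mul_le_one₀ hr h1 h2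
    have h4 := mul_nonneg hr0 h1
    constructor <;> linarith
  have hd : ∀ t ∈ Ioi (0 : ℝ), HasDerivAt (fun t => dilog (1 - r * (t / (1 + t))))
      (-Real.log (1 - r * (t / (1 + t))) / (t * (1 + t))) t := by
    intro t ht
    have ht0 : 0 < t := ht
    have h1t : 0 < 1 + t := by linarith
    obtain ⟨h1, h2⟩ := hx t ht0
    have h3 : r * (t / (1 + t)) < 1 := by nlinarith
    have h4 : 0 < r * (t / (1 + t)) := by positivity
    have hi : HasDerivAt (fun t : ℝ => 1 - r * (t / (1 + t)))
        (-(r * ((1 * (1 + t) - t * 1) / (1 + t) ^ 2))) t :=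
      ((((hasDerivAt_id t).div ((hasDerivAt_id t).const_add 1) h1t.ne').const_mul r).const_sub 1)
    refine ((hasDerivAt_dilog (by linarith) (by linarith)).comp t hi).congr_deriv ?_
    obtain ⟨ℓ, hℓ⟩ : ∃ ℓ, ℓ = Real.log (1 - r * (t / (1 + t))) := ⟨_, rfl⟩
    rw [← hℓ, sub_sub_cancel_left]
    field_simp
    ring
  have h0 : ∀ t ∈ Ioi (0 : ℝ), 0 ≤ -Real.log (1 - r * (t / (1 + t))) / (t * (1 + t)) := by
    intro t ht
    have ht0 : 0 < t := ht
    have h1 := hmem t ht0.le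
    exact div_nonneg (neg_nonneg.2 (Real.log_nonpos h1.1 h1.2)) (by positivity)
  have hcont : ContinuousWithinAt (fun t => dilog (1 - r * (t / (1 + t)))) (Ici 0) 0 := by
    have h1 : ContinuousWithinAt (fun t : ℝ => 1 - r * (t / (1 + t))) (Ici 0) 0 := by
      refine ContinuousAt.continuousWithinAt ?_
      have : ContinuousAt (fun t : ℝ => t / (1 + t)) 0 :=
        ContinuousAt.div (by fun_prop) (by fun_prop) (by norm_num)
      fun_prop
    exact ContinuousWithinAt.comp (g := dilog) (t := Icc 0 1) (continuousOn_dilog _ (hmem 0 le_rfl)) h1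
      fun t ht => hmem t ht
  have hlim : Tendsto (fun t => dilog (1 - r * (t / (1 + t)))) atTop (𝓝 (dilog (1 - r))) := by
    have h1 : Tendsto (fun t : ℝ => 1 - r * (t / (1 + t))) atTop (𝓝 (1 - r * (1 - 0))) := by
      refine tendsto_const_nhds.sub (Tendsto.const_mul _ ?_)
      have h2 : Tendsto (fun t : ℝ => 1 - (1 + t)⁻¹) atTop (𝓝 (1 - 0)) :=
        tendsto_const_nhds.sub (tendsto_inv_atTop_zero.comp
          (tendsto_atTop_add_const_left _ _ tendsto_id))
      refine h2.congr' ?_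
      filter_upwards [eventually_ge_atTop 0] with t ht
      have : 0 < 1 + t := by linarith
      field_simp
      ring
    rw [sub_zero, mul_one] at h1
    have h3 := continuousOn_dilog (1 - r) ⟨by linarith, by linarith⟩
    refine Tendsto.comp (g := dilog) h3 (tendsto_nhdsWithin_iff.2 ⟨h1, ?_⟩)
    filter_upwards [eventually_ge_atTop 0] with t ht using hmem t ht
  rw [← ofReal_integral_eq_lintegral_ofReal (integrableOn_Ioi_deriv_of_nonneg hcont hd h0 hlim)
    (ae_restrict_of_forall_mem measurableSet_Ioi h0),
    integral_Ioi_of_hasDerivAt_of_nonneg hcont hd h0 hlim]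
  congr 1
  simp [dilog_one]

/-! ### High-SNR limit of the covariance -/

theorem tendsto_lintegral_exp_mul_covKernel {r : ℝ} (hr0 : 0 ≤ r) (hr : r ≤ 1) :
    Tendsto (fun γ : ℝ => ∫⁻ z, ENNReal.ofReal
      (Real.exp (-(γ⁻¹ * (z.1 + z.2))) * covKernel r z.1 z.2)
      ∂((volume.restrict (Ioi (0 : ℝ))).prod (volume.restrict (Ioi (0 : ℝ))))) atTop
      (𝓝 (ENNReal.ofReal (dilog (1 - r)))) := by
  have hpos : ∀ᵐ z ∂((volume.restrict (Ioi (0 : ℝ))).prod (volume.restrict (Ioi (0 : ℝ)))),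
      0 < z.1 ∧ 0 < z.2 := by
    rw [Measure.prod_restrict]
    exact ae_restrict_of_forall_mem (measurableSet_Ioi.prod measurableSet_Ioi) fun z hz => hz
  have hk := measurable_covKernel r
  rw [← lintegral_covKernel hr0 hr]
  refine tendsto_lintegral_filter_of_dominated_convergence
    (fun z => ENNReal.ofReal (covKernel r z.1 z.2)) (.of_forall fun γ => by fun_prop) ?_ ?_ ?_
  · filter_upwards [eventually_gt_atTop 0] with γ hγ
    filter_upwards [hpos] with z hz
    refine ENNReal.ofReal_le_ofReal ?_
    refine mul_le_of_le_one_left (covKernel_nonneg hr0 hr hz.1.le hz.2.le) ?_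
    rw [Real.exp_le_one_iff, neg_nonpos]
    exact mul_nonneg (inv_nonneg.2 hγ.le) (add_nonneg hz.1.le hz.2.le)
  · rw [lintegral_covKernel hr0 hr]
    exact ENNReal.ofReal_ne_top
  · refine .of_forall fun z => ENNReal.tendsto_ofReal ?_
    have h1 : Tendsto (fun γ : ℝ => Real.exp (-(γ⁻¹ * (z.1 + z.2))) * covKernel r z.1 z.2) atTop
        (𝓝 (Real.exp (-(0 * (z.1 + z.2))) * covKernel r z.1 z.2)) :=
      (((tendsto_inv_atTop_zero.mul_const _).neg).rexp).mul_const _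
    simpa using h1

/-- From `1 + x ≤ (1 + √x)²`. It makes a first moment of the channel gain enough for a second moment
of the logarithm. -/
theorem log_one_add_sq_le {x : ℝ} (hx : 0 ≤ x) : Real.log (1 + x) ^ 2 ≤ 4 * x := by
  have h1 : Real.log (1 + x) ≤ 2 * Real.sqrt x := by
    have h2 : Real.log (1 + x) ≤ Real.log ((1 + Real.sqrt x) ^ 2) := by
      refine Real.log_le_log (by linarith) ?_
      nlinarith [Real.sq_sqrt hx, Real.sqrt_nonneg x]
    have h3 := Real.log_le_sub_one_of_pos (x := 1 + Real.sqrt x) (by positivity)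
    rw [Real.log_pow] at h2
    push_cast at h2
    linarith
  have h4 : 0 ≤ Real.log (1 + x) := Real.log_nonneg (by linarith)
  calc Real.log (1 + x) ^ 2 ≤ (2 * Real.sqrt x) ^ 2 := by gcongr
    _ = 4 * x := by rw [mul_pow, Real.sq_sqrt hx]; norm_num

theorem memLp_log_one_add_mul [IsProbabilityMeasure μ] {A : Ω → ℝ} (hA : Integrable A μ)
    (hA0 : ∀ ω, 0 ≤ A ω) {γ : ℝ} (hγ : 0 < γ) :
    MemLp (fun ω => Real.log (1 + γ * A ω)) 2 μ := by
  have hm := hA.aemeasurable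
  have hm' : AEMeasurable (fun ω => Real.log (1 + γ * A ω)) μ := by fun_prop
  rw [memLp_two_iff_integrable_sq hm'.aestronglyMeasurable]
  refine (hA.const_mul (4 * γ)).mono' (hm'.pow_const 2).aestronglyMeasurable ?_
  refine .of_forall fun ω => ?_
  rw [Real.norm_of_nonneg (sq_nonneg _), mul_assoc]
  exact log_one_add_sq_le (mul_nonneg hγ.le (hA0 ω))

theorem tendsto_covariance_log_one_add_mul [IsProbabilityMeasure μ] {A B : Ω → ℝ}
    (hA : Integrable A μ) (hB : Integrable B μ) (hA0 : ∀ ω, 0 ≤ A ω) (hB0 : ∀ ω, 0 ≤ B ω) {r : ℝ}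
    (hr0 : 0 ≤ r) (hr : r ≤ 1)
    (hlap : ∀ t s : ℝ, 0 ≤ t → 0 ≤ s → ∫ ω, Real.exp (-(t * A ω + s * B ω)) ∂μ =
      1 / ((1 + t) * (1 + s) - r * (t * s))) :
    Tendsto (fun γ : ℝ => cov[fun ω => Real.log (1 + γ * A ω), fun ω => Real.log (1 + γ * B ω); μ])
      atTop (𝓝 (dilog (1 - r))) := by
  have hlim := (ENNReal.tendsto_toReal ENNReal.ofReal_ne_top).comp
    (tendsto_lintegral_exp_mul_covKernel hr0 hr)
  rw [ENNReal.toReal_ofReal (dilog_nonneg (by linarith) (by linarith))] at hlim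
  refine hlim.congr' ?_
  filter_upwards [eventually_gt_atTop 0] with γ hγ
  have hMA := memLp_log_one_add_mul hA hA0 hγ
  have hMB := memLp_log_one_add_mul hB hB0 hγ
  have hAlog : ∀ ω, 0 ≤ Real.log (1 + γ * A ω) := fun ω =>
    Real.log_nonneg (by linarith [mul_nonneg hγ.le (hA0 ω)])
  have hBlog : ∀ ω, 0 ≤ Real.log (1 + γ * B ω) := fun ω =>
    Real.log_nonneg (by linarith [mul_nonneg hγ.le (hB0 ω)])
  have key := lintegral_mul_log_eq_add hA.aemeasurable hB.aemeasurable hA0 hB0 hr0 hr hlap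
    (inv_pos.2 hγ)
  simp_rw [div_inv_eq_mul, mul_comm _ γ, ← ENNReal.ofReal_mul (hAlog _)] at key
  have hMAB : Integrable (fun ω => Real.log (1 + γ * A ω) * Real.log (1 + γ * B ω)) μ :=
    hMA.integrable_mul hMB
  rw [← ofReal_integral_eq_lintegral_ofReal hMAB
      (.of_forall fun ω => mul_nonneg (hAlog ω) (hBlog ω)),
    ← ofReal_integral_eq_lintegral_ofReal (hMA.integrable (by norm_num)) (.of_forall hAlog),
    ← ofReal_integral_eq_lintegral_ofReal (hMB.integrable (by norm_num)) (.of_forall hBlog),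
    ← ENNReal.ofReal_mul (integral_nonneg hAlog)] at key
  -- Finiteness is read off from `key`, whose left side is finite.
  have hJ : ∫⁻ z, ENNReal.ofReal (Real.exp (-(γ⁻¹ * (z.1 + z.2))) * covKernel r z.1 z.2)
      ∂((volume.restrict (Ioi (0 : ℝ))).prod (volume.restrict (Ioi (0 : ℝ)))) ≠ ⊤ := by
    intro h
    rw [h, add_top] at key
    exact ENNReal.ofReal_ne_top key
  have key2 := congrArg ENNReal.toReal key
  rw [ENNReal.toReal_add ENNReal.ofReal_ne_top hJ,
    ENNReal.toReal_ofReal (integral_nonneg fun ω => mul_nonneg (hAlog ω) (hBlog ω)),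
    ENNReal.toReal_ofReal (mul_nonneg (integral_nonneg hAlog) (integral_nonneg hBlog))] at key2
  rw [covariance_eq_sub hMA hMB]
  simp only [Function.comp_apply]
  have : ∫ ω, ((fun ω => Real.log (1 + γ * A ω)) * fun ω => Real.log (1 + γ * B ω)) ω ∂μ =
    ∫ ω, Real.log (1 + γ * A ω) * Real.log (1 + γ * B ω) ∂μ := rfl
  linarith

/-- Each difference `d > 0` occurs `n - d` times with either sign. Doubling also counts the diagonal
twice, hence the subtracted `n * f 0`. -/
theorem sum_range_sum_range_sub_eq (f : ℤ → ℝ) (hf : ∀ d, f (-d) = f d) (n : ℕ) :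
    ∑ k ∈ Finset.range n, ∑ l ∈ Finset.range n, f ((k : ℤ) - l) =
      2 * ∑ d ∈ Finset.range n, ((n : ℝ) - d) * f d - n * f 0 := by
  induction n with
  | zero => simp
  | succ n ih =>
    have h1 : ∀ k : ℕ, ∑ l ∈ Finset.range (n + 1), f ((k : ℤ) - l) =
        ∑ l ∈ Finset.range n, f ((k : ℤ) - l) + f ((k : ℤ) - n) := fun k =>
      Finset.sum_range_succ _ _
    have h2 : ∑ k ∈ Finset.range n, f ((k : ℤ) - n) = ∑ k ∈ Finset.range n, f ((n : ℤ) - k) :=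
      Finset.sum_congr rfl fun k _ => by rw [← hf, neg_sub]
    have h3 : ∑ k ∈ Finset.range n, f ((n : ℤ) - k) =
        ∑ d ∈ Finset.range n, f (d + 1 : ℕ) := by
      rw [← Finset.sum_range_reflect (fun d : ℕ => f (d + 1 : ℕ))]
      refine Finset.sum_congr rfl fun k hk => ?_
      have := Finset.mem_range.1 hk
      congr 1
      omega
    have h4 : ∑ d ∈ Finset.range (n + 1), (((n + 1 : ℕ) : ℝ) - d) * f d =
        ∑ d ∈ Finset.range n, ((n : ℝ) - d) * f d + ∑ d ∈ Finset.range (n + 1), f d := by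
      have h5 : ∑ d ∈ Finset.range n, ((n : ℝ) - d) * f d =
          ∑ d ∈ Finset.range (n + 1), ((n : ℝ) - d) * f d := by
        rw [Finset.sum_range_succ, sub_self, zero_mul, add_zero]
      rw [h5, ← Finset.sum_add_distrib]
      refine Finset.sum_congr rfl fun d _ => ?_
      push_cast
      ring
    rw [Finset.sum_range_succ, Finset.sum_congr rfl fun k _ => h1 k, Finset.sum_add_distrib, ih,
      h1, h2, h3, h4, Finset.sum_range_succ' (fun d : ℕ => f d), sub_self]
    push_cast
    ring

/-! ### Second moments of linear forms in the taps -/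

theorem memLp_two_stdComplexGaussian : MemLp (fun z : ℂ => z) 2 stdComplexGaussian := by
  rw [stdComplexGaussian, memLp_map_measure_iff (by fun_prop) measurable_complex_mk.aemeasurable]
  have h : MemLp (fun x : ℝ => x) 2 (gaussianReal 0 (1 / 2)) :=
    memLp_id_gaussianReal' 2 (by norm_num)
  have h1 : MemLp (fun z : ℝ × ℝ => (z.1 : ℂ)) 2
      ((gaussianReal 0 (1 / 2)).prod (gaussianReal 0 (1 / 2))) := (h.comp_fst _).ofReal
  have h2 : MemLp (fun z : ℝ × ℝ => (z.2 : ℂ)) 2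
      ((gaussianReal 0 (1 / 2)).prod (gaussianReal 0 (1 / 2))) := (h.comp_snd _).ofReal
  refine (h1.add (h2.mul_const Complex.I)).ae_eq (.of_forall fun z => ?_)
  simp [Complex.ext_iff]

theorem integral_id_stdComplexGaussian : ∫ z : ℂ, z ∂stdComplexGaussian = 0 := by
  rw [stdComplexGaussian, integral_map measurable_complex_mk.aemeasurable
    (Measurable.aestronglyMeasurable (by fun_prop))]
  have h : Integrable (fun x : ℝ => x) (gaussianReal 0 (1 / 2)) :=
    memLp_one_iff_integrable.1 (memLp_id_gaussianReal' 1 (by norm_num))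
  have e : ∀ z : ℝ × ℝ, (⟨z.1, z.2⟩ : ℂ) = (z.1 : ℂ) + (z.2 : ℂ) * Complex.I := fun z => by
    simp [Complex.ext_iff]
  simp_rw [e]
  rw [integral_add (h.comp_fst _).ofReal ((h.comp_snd _).ofReal.mul_const _), integral_mul_const,
    integral_fun_fst (fun x : ℝ => (x : ℂ)), integral_fun_snd (fun x : ℝ => (x : ℂ)),
    integral_complex_ofReal, integral_id_gaussianReal]
  simp

theorem integral_mul_conj_stdComplexGaussian :
    ∫ z : ℂ, z * starRingEnd ℂ z ∂stdComplexGaussian = 1 := by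
  rw [stdComplexGaussian, integral_map measurable_complex_mk.aemeasurable
    (Measurable.aestronglyMeasurable (by fun_prop))]
  have h : Integrable (fun x : ℝ => x ^ 2) (gaussianReal 0 (1 / 2)) :=
    (memLp_id_gaussianReal' 2 (by norm_num)).integrable_sq
  have hv : ∫ x, x ^ 2 ∂(gaussianReal 0 (1 / 2)) = 1 / 2 := by
    have h1 := variance_fun_id_gaussianReal (μ := 0) (v := 1 / 2)
    rw [variance_of_integral_eq_zero (by fun_prop) integral_id_gaussianReal] at h1
    rw [h1]
    norm_num
  have e : ∀ z : ℝ × ℝ, (⟨z.1, z.2⟩ : ℂ) * starRingEnd ℂ ⟨z.1, z.2⟩ =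
      ((z.1 ^ 2 + z.2 ^ 2 : ℝ) : ℂ) := fun z => by
    rw [Complex.mul_conj, Complex.normSq_mk]
    ring_nf
  simp_rw [e]
  rw [integral_complex_ofReal, integral_add (h.comp_fst _) (h.comp_snd _),
    integral_fun_fst (fun x : ℝ => x ^ 2), integral_fun_snd (fun x : ℝ => x ^ 2), hv]
  norm_num

section LinearForms

variable {ι : Type*} {h : ι → Ω → ℂ}

theorem memLp_two_of_hasLaw_stdComplexGaussian {X : Ω → ℂ} (hX : HasLaw X stdComplexGaussian μ) :
    MemLp X 2 μ := by
  have h := memLp_two_stdComplexGaussian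
  rw [← hX.map_eq, memLp_map_measure_iff (by fun_prop) hX.aemeasurable] at h
  exact h

theorem integral_mul_conj_of_iIndepFun [DecidableEq ι] (hind : iIndepFun h μ)
    (hlaw : ∀ p, HasLaw (h p) stdComplexGaussian μ) (p q : ι) :
    ∫ ω, h p ω * starRingEnd ℂ (h q ω) ∂μ = if p = q then 1 else 0 := by
  split_ifs with hpq
  · subst hpq
    rw [← integral_mul_conj_stdComplexGaussian, ← (hlaw p).map_eq,
      integral_map (hlaw p).aemeasurable (Measurable.aestronglyMeasurable (by fun_prop))]
  · have hi : IndepFun (h p) (fun ω => starRingEnd ℂ (h q ω)) μ :=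
      (hind.indepFun hpq).comp measurable_id (RCLike.continuous_conj.measurable)
    have h0 : ∫ ω, h p ω ∂μ = 0 := by
      rw [← integral_id_stdComplexGaussian, ← (hlaw p).map_eq,
        integral_map (hlaw p).aemeasurable (Measurable.aestronglyMeasurable (by fun_prop))]
    rw [hi.integral_fun_mul_eq_mul_integral (hlaw p).aemeasurable.aestronglyMeasurable
      (RCLike.continuous_conj.measurable.comp_aemeasurable
        (hlaw q).aemeasurable).aestronglyMeasurable, h0, zero_mul]

variable [Fintype ι]

theorem memLp_two_sum_of_hasLaw (hlaw : ∀ p, HasLaw (h p) stdComplexGaussian μ) (u : ι → ℂ) :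
    MemLp (fun ω => ∑ p, u p * h p ω) 2 μ :=
  memLp_finsetSum _ fun p _ => (memLp_two_of_hasLaw_stdComplexGaussian (hlaw p)).const_mul (u p)

theorem integrable_sum_mul_conj_sum (hlaw : ∀ p, HasLaw (h p) stdComplexGaussian μ)
    (u v : ι → ℂ) :
    Integrable (fun ω => (∑ p, u p * h p ω) * starRingEnd ℂ (∑ p, v p * h p ω)) μ :=
  (memLp_two_sum_of_hasLaw hlaw u).integrable_mul (memLp_two_sum_of_hasLaw hlaw v).star

theorem integral_sum_mul_conj_sum (hind : iIndepFun h μ)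
    (hlaw : ∀ p, HasLaw (h p) stdComplexGaussian μ) (u v : ι → ℂ) :
    ∫ ω, (∑ p, u p * h p ω) * starRingEnd ℂ (∑ p, v p * h p ω) ∂μ =
      ∑ p, u p * starRingEnd ℂ (v p) := by
  classical
  have e : ∀ ω, (∑ p, u p * h p ω) * starRingEnd ℂ (∑ p, v p * h p ω) =
      ∑ p, ∑ q, (u p * starRingEnd ℂ (v q)) * (h p ω * starRingEnd ℂ (h q ω)) := by
    intro ω
    rw [map_sum, Finset.sum_mul_sum]
    refine Finset.sum_congr rfl fun p _ => Finset.sum_congr rfl fun q _ => ?_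
    rw [map_mul]
    ring
  have hint : ∀ p q, Integrable
      (fun ω => (u p * starRingEnd ℂ (v q)) * (h p ω * starRingEnd ℂ (h q ω))) μ := fun p q =>
    ((memLp_two_of_hasLaw_stdComplexGaussian (hlaw p)).integrable_mul
      (memLp_two_of_hasLaw_stdComplexGaussian (hlaw q)).star).const_mul _
  simp_rw [e]
  rw [integral_finsetSum _ fun p _ => integrable_finsetSum _ fun q _ => hint p q]
  refine Finset.sum_congr rfl fun p _ => ?_
  rw [integral_finsetSum _ fun q _ => hint p q]
  simp_rw [integral_const_mul, integral_mul_conj_of_iIndepFun hind hlaw]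
  simp

theorem integrable_norm_sq_sum (hlaw : ∀ p, HasLaw (h p) stdComplexGaussian μ) (u : ι → ℂ) :
    Integrable (fun ω => ‖∑ p, u p * h p ω‖ ^ 2) μ :=
  (memLp_two_sum_of_hasLaw hlaw u).integrable_norm_pow (by norm_num)

end LinearForms

/-! ### Subcarrier coefficients and the scalar channel -/

/-- The coefficient of tap `p` in the frequency response of subcarrier `k`. -/
noncomputable def tapCoeff {L : ℕ} (N : ℕ) (σ : Fin L → ℝ) (k : ℕ) (p : Fin L) : ℂ :=
  (σ p : ℂ) * Complex.exp (-(2 * Real.pi * Complex.I * ((k : ℂ) / (N : ℂ)) * (p : ℕ)))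

theorem norm_sq_tapCoeff {L : ℕ} (N : ℕ) (σ : Fin L → ℝ) (k : ℕ) (p : Fin L) :
    ‖tapCoeff N σ k p‖ ^ 2 = σ p ^ 2 := by
  have e : (-(2 * Real.pi * Complex.I * ((k : ℂ) / (N : ℂ)) * (p : ℕ))) =
      ((-(2 * Real.pi * (k / N) * (p : ℕ)) : ℝ) : ℂ) * Complex.I := by
    push_cast
    ring
  rw [tapCoeff, e, norm_mul, Complex.norm_exp_ofReal_mul_I, mul_one, Complex.norm_real,
    Real.norm_eq_abs, sq_abs]

theorem sum_tapCoeff_mul_conj {L : ℕ} (N : ℕ) (σ : Fin L → ℝ) (k l : ℕ) :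
    ∑ p, tapCoeff N σ k p * starRingEnd ℂ (tapCoeff N σ l p) =
      freqCorr N σ ((k : ℤ) - (l : ℤ)) := by
  refine Finset.sum_congr rfl fun p _ => ?_
  rw [tapCoeff, tapCoeff, map_mul, Complex.conj_ofReal, ← Complex.exp_conj, mul_mul_mul_comm,
    ← Complex.exp_add, ← sq]
  congr 2
  simp only [map_neg, map_mul, map_div₀, Complex.conj_ofReal, Complex.conj_I, map_ofNat,
    map_natCast]
  push_cast
  ring

/-- Since `σ` is real, `ρ_{-d}` is the conjugate of `ρ_d`. This supplies the evenness needed to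
group pairs by difference. -/
theorem norm_freqCorr_neg {L : ℕ} (N : ℕ) (σ : Fin L → ℝ) (d : ℤ) :
    ‖freqCorr N σ (-d)‖ = ‖freqCorr N σ d‖ := by
  rw [← RCLike.norm_conj (freqCorr N σ d)]
  congr 1
  rw [freqCorr, freqCorr, map_sum]
  refine Finset.sum_congr rfl fun p _ => ?_
  rw [map_mul, map_pow, Complex.conj_ofReal, ← Complex.exp_conj]
  congr 2
  simp only [map_neg, map_mul, map_div₀, Complex.conj_ofReal, Complex.conj_I, map_ofNat,
    map_natCast, map_intCast]
  push_cast
  ring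

theorem freqCorr_zero {L : ℕ} (N : ℕ) {σ : Fin L → ℝ} (hσ : ∑ p, σ p ^ 2 = 1) :
    freqCorr N σ 0 = 1 := by
  simp only [freqCorr, Int.cast_zero, mul_zero, zero_mul, zero_div, neg_zero, Complex.exp_zero,
    mul_one]
  exact_mod_cast hσ

theorem subcarrierChannel_apply_zero {Ω : Type*} [MeasurableSpace Ω] {L N : ℕ} (σ : Fin L → ℝ)
    (H : Fin L → Ω → Matrix (Fin 1) (Fin 1) ℂ) (k : ℕ) (ω : Ω) :
    subcarrierChannel N σ H k ω 0 0 = ∑ p, tapCoeff N σ k p * H p ω 0 0 := by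
  rw [subcarrierChannel, Matrix.sum_apply]
  rfl

theorem flatMutualInfo_one (γ : ℝ) (A : Matrix (Fin 1) (Fin 1) ℂ) :
    flatMutualInfo γ A = (Real.log 2)⁻¹ * Real.log (1 + γ * ‖A 0 0‖ ^ 2) := by
  have e : A 0 0 * starRingEnd ℂ (A 0 0) = ((‖A 0 0‖ ^ 2 : ℝ) : ℂ) := by
    rw [Complex.mul_conj, Complex.normSq_eq_norm_sq]
  rw [flatMutualInfo, Matrix.det_fin_one]
  simp only [Matrix.add_apply, Matrix.smul_apply, Matrix.mul_apply, Matrix.conjTranspose_apply,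
    Finset.univ_unique, Finset.sum_singleton, Fin.default_eq_zero, Matrix.one_apply_eq,
    Nat.cast_one, div_one, smul_eq_mul]
  rw [← starRingEnd_apply, e, ← Complex.ofReal_mul, Complex.add_re, Complex.one_re,
    Complex.ofReal_re, Real.logb, div_eq_inv_mul]

end OFDM

/-! ### Assembly of the variance -/

theorem mainTheorem6 {Ω : Type*} [MeasurableSpace Ω] (μ : Measure Ω) [IsProbabilityMeasure μ]
    (N L : ℕ) (hN : 0 < N) (σ : Fin L → ℝ) (hσ : ∑ p, σ p ^ 2 = 1)
    (H : Fin L → Ω → Matrix (Fin 1) (Fin 1) ℂ) (hH : OFDM.IsRayleighFading μ H) :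
    (∀ k ℓ : ℕ, k < N → ℓ < N →
      Integrable (fun ω => OFDM.subcarrierChannel N σ H k ω 0 0 *
        (starRingEnd ℂ) (OFDM.subcarrierChannel N σ H ℓ ω 0 0)) μ ∧
      ∫ ω, OFDM.subcarrierChannel N σ H k ω 0 0 *
        (starRingEnd ℂ) (OFDM.subcarrierChannel N σ H ℓ ω 0 0) ∂μ
          = OFDM.freqCorr N σ ((k : ℤ) - (ℓ : ℤ))) ∧
    (∀ γ : ℝ, 0 < γ → MemLp (OFDM.mutualInfo N σ H γ) 2 μ) ∧
    Filter.Tendsto (fun γ : ℝ => variance (OFDM.mutualInfo N σ H γ) μ) Filter.atTop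
      (nhds ((Real.logb 2 (Real.exp 1)) ^ 2 *
        (2 / (N : ℝ) ^ 2 * ∑ d ∈ Finset.Icc 1 (N - 1),
            ((N : ℝ) - (d : ℝ)) * OFDM.dilog (1 - ‖OFDM.freqCorr N σ (d : ℤ)‖ ^ 2)
          + Real.pi ^ 2 / (6 * (N : ℝ))))) := by
  have hind : iIndepFun (fun (p : Fin L) (ω : Ω) => H p ω 0 0) μ :=
    hH.indep.precomp (g := fun p : Fin L => (p, (0 : Fin 1), (0 : Fin 1)))
      fun p q hpq => (Prod.ext_iff.1 hpq).1
  have hlaw : ∀ p, HasLaw (fun ω => H p ω 0 0) OFDM.stdComplexGaussian μ := fun p => hH.law p 0 0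
  have hnorm : ∀ k, ∑ p, ‖OFDM.tapCoeff N σ k p‖ ^ 2 = 1 := fun k => by
    simp_rw [OFDM.norm_sq_tapCoeff, hσ]
  set A : ℕ → Ω → ℝ := fun k ω => ‖∑ p, OFDM.tapCoeff N σ k p * H p ω 0 0‖ ^ 2 with hA
  have hAint : ∀ k, Integrable (A k) μ := fun k => OFDM.integrable_norm_sq_sum hlaw _
  have hA0 : ∀ k ω, 0 ≤ A k ω := fun k ω => sq_nonneg _
  have hmi : ∀ γ, OFDM.mutualInfo N σ H γ = fun ω => (1 / (N : ℝ) * (Real.log 2)⁻¹) *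
      ∑ k ∈ Finset.range N, Real.log (1 + γ * A k ω) := by
    intro γ
    ext ω
    simp only [OFDM.mutualInfo, OFDM.flatMutualInfo_one, OFDM.subcarrierChannel_apply_zero, hA]
    rw [← Finset.mul_sum, mul_assoc]
  refine ⟨fun k l _ _ => ?_, fun γ hγ => ?_, ?_⟩
  · simp_rw [OFDM.subcarrierChannel_apply_zero]
    exact ⟨OFDM.integrable_sum_mul_conj_sum hlaw _ _, by
      rw [OFDM.integral_sum_mul_conj_sum hind hlaw, OFDM.sum_tapCoeff_mul_conj]⟩
  · rw [hmi]
    exact (memLp_finsetSum _ fun k _ =>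
      OFDM.memLp_log_one_add_mul (hAint k) (hA0 k) hγ).const_mul _
  set f : ℤ → ℝ := fun d => OFDM.dilog (1 - ‖OFDM.freqCorr N σ d‖ ^ 2) with hf
  have hcov : ∀ k l : ℕ, Filter.Tendsto (fun γ : ℝ =>
      cov[fun ω => Real.log (1 + γ * A k ω), fun ω => Real.log (1 + γ * A l ω); μ])
      Filter.atTop (nhds (f ((k : ℤ) - l))) := by
    intro k l
    have hr := OFDM.norm_sum_mul_conj_le (hnorm k) (hnorm l)
    have hlap := fun (t s : ℝ) (ht : 0 ≤ t) (hs : 0 ≤ s) =>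
      OFDM.integral_exp_neg_norm_sq_of_iIndepFun hind hlaw (hnorm k) (hnorm l) ht hs
    rw [OFDM.sum_tapCoeff_mul_conj] at hr
    simp_rw [OFDM.sum_tapCoeff_mul_conj] at hlap
    exact OFDM.tendsto_covariance_log_one_add_mul (hAint k) (hAint l) (hA0 k) (hA0 l)
      (sq_nonneg _) (pow_le_one₀ (norm_nonneg _) hr) hlap
  have hlim : Filter.Tendsto (fun γ : ℝ => (1 / (N : ℝ) * (Real.log 2)⁻¹) ^ 2 *
      ∑ k ∈ Finset.range N, ∑ l ∈ Finset.range N,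
        cov[fun ω => Real.log (1 + γ * A k ω), fun ω => Real.log (1 + γ * A l ω); μ])
      Filter.atTop (nhds ((1 / (N : ℝ) * (Real.log 2)⁻¹) ^ 2 *
        ∑ k ∈ Finset.range N, ∑ l ∈ Finset.range N, f ((k : ℤ) - l))) :=
    (tendsto_finsetSum _ fun k _ => tendsto_finsetSum _ fun l _ => hcov k l).const_mul _
  have hf0 : f 0 = Real.pi ^ 2 / 6 := by
    simp only [hf]
    rw [OFDM.freqCorr_zero N hσ, norm_one, one_pow, sub_self, OFDM.dilog_zero]
  have hval : (1 / (N : ℝ) * (Real.log 2)⁻¹) ^ 2 *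
      ∑ k ∈ Finset.range N, ∑ l ∈ Finset.range N, f ((k : ℤ) - l) =
      (Real.logb 2 (Real.exp 1)) ^ 2 * (2 / (N : ℝ) ^ 2 * ∑ d ∈ Finset.Icc 1 (N - 1),
        ((N : ℝ) - (d : ℝ)) * f d + Real.pi ^ 2 / (6 * (N : ℝ))) := by
    -- The `d = 0` term is split off: `2 N f 0 - N f 0 = N f 0`, which over `N²` becomes `π² / (6
    -- N)`.
    have hsplit : ∑ d ∈ Finset.range N, ((N : ℝ) - d) * f d =
        N * f 0 + ∑ d ∈ Finset.Icc 1 (N - 1), ((N : ℝ) - d) * f d := by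
      rw [Finset.range_eq_Ico, Finset.sum_eq_sum_Ico_succ_bot hN]
      have hset : Finset.Ico (0 + 1) N = Finset.Icc 1 (N - 1) := by
        ext d
        simp only [Finset.mem_Ico, Finset.mem_Icc]
        omega
      rw [hset]
      simp
    rw [OFDM.sum_range_sum_range_sub_eq f (fun d => by simp only [hf, OFDM.norm_freqCorr_neg]),
      hsplit, hf0, Real.logb, Real.log_exp]
    have hN' : (N : ℝ) ≠ 0 := by exact_mod_cast hN.ne'
    have hl2 : Real.log 2 ≠ 0 := (Real.log_pos (by norm_num)).ne'
    field_simp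
    ring
  rw [hval] at hlim
  refine hlim.congr' ?_
  -- Expanding the variance into covariances uses square integrability of the logarithms,
  -- established for `γ > 0`.
  filter_upwards [Filter.eventually_gt_atTop 0] with γ hγ
  rw [hmi, variance_const_mul, variance_fun_sum' fun k _ =>
    OFDM.memLp_log_one_add_mul (hAint k) (hA0 k) hγ]
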